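/- Let $k$ be a field. A tensor category over $k$ is a $k$-linear abelian monoidal category $\mathcal C$ whose tensor product is $k$-bilinear and exact in each variable and with $\dim_k\mathrm{End}(\mathbf 1)=1$. Let $\underline{\mathrm{Aut}_\otimes(\mathcal C)}$ be the monoidal category whose objects are the tensor autoequivalences of $\mathcal C$ ($k$-linear strong monoidal functors $\mathcal C\to\mathcal C$ that are equivalences), whose arrows are the monoidal natural isomorphisms, and whose tensor product is composition of functors. An action of a group $G$ on $\mathcal C$ is a monoidal functor $\underline G\to\underline{\mathrm{Aut}_\otimes(\mathcal C)}$, where $\underline G$ is the discrete monoidal category on $G$; two actions are equivalent if these monoidal functors are isomorphic by a monoidal natural isomorphism. Let $m\ge 1$ and let $C_m=\langle\sigma\rangle$ be the cyclic group of order $m$. Consider pairs $(F,\alpha)$, where $F$ is a tensor autoequivalence of $\mathcal C$ and $\alpha:F^m\to\mathrm{id}_{\mathcal C}$ is a monoidal natural isomorphism with $\mathrm{id}_F\otimes\alpha=\alpha\otimes\mathrm{id}_F$, that is, $F(\alpha_X)=\alpha_{F(X)}$ for all $X\in\mathcal C$. Each such pair induces a $C_m$-action on $\mathcal C$ by $\sigma^i\mapsto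 F^i$ for $0\le i<m$, where for $0\le i,j<m$ the structure isomorphism from $F^i\circ F^j$ to the functor assigned to $\sigma^{i+j}$ is the identity of $F^{i+j}$ if $i+j<m$, and $\mathrm{id}_{F^{i+j-m}}\otimes\alpha:F^{i+j}\to F^{i+j-m}$ if $i+j\ge m$. Then: 1. every $C_m$-action on $\mathcal C$ is equivalent to the action induced by some pair $(F,\alpha)$; 2. two pairs $(F_1,\alpha_1)$ and $(F_2,\alpha_2)$ induce equivalent $C_m$-actions if and only if there is a monoidal natural isomorphism $\theta:F_1\to F_2$ such that $\alpha_2\circ\theta^{m}=\alpha_1$, where $\theta^{m}=\theta\otimes\cdots\otimes\theta:F_1^m\to F_2^m$. Consequently the assignment $(F,\alpha)\mapsto$ induced action gives a bijection between the set of pairs modulo the relation in (2) and the set of equivalence classes of $C_m$-actions on $\mathcal C$. -/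

import Mathlib

open CategoryTheory MonoidalCategory

/-! ### Tensor categories -/

/-- A tensor category over a field `k`: a `k`-linear abelian monoidal category whose tensor
product is `k`-bilinear and exact in each variable and with `dim_k End(𝟙) = 1`. -/
class IsTensorCategory (k : Type*) [Field k] (C : Type*) [Category C] [Abelian C] [Linear k C]
    [MonoidalCategory C] : Prop where
  monoidalPreadditive : MonoidalPreadditive C
  monoidalLinear : MonoidalLinear k C
  tensorLeft_preservesFiniteLimits (X : C) : Limits.PreservesFiniteLimits (tensorLeft X)
  tensorLeft_preservesFiniteColimits (X : C) : Limits.PreservesFiniteColimits (tensorLeft X)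
  tensorRight_preservesFiniteLimits (X : C) : Limits.PreservesFiniteLimits (tensorRight X)
  tensorRight_preservesFiniteColimits (X : C) : Limits.PreservesFiniteColimits (tensorRight X)
  finrank_end_unit : Module.finrank k (𝟙_ C ⟶ 𝟙_ C) = 1

/-! ### The monoidal category of tensor autoequivalences -/

/-- Objects of `Aut_⊗(C)`: tensor autoequivalences, that is, `k`-linear (strong) monoidal functors
`C ⥤ C` which are equivalences of categories. -/
structure TensorAut (k : Type*) [Field k] (C : Type*) [Category C] [Preadditive C] [Linear k C]
    [MonoidalCategory C] where
  toFunctor : C ⥤ C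
  [monoidal : toFunctor.Monoidal]
  [additive : toFunctor.Additive]
  [linear : toFunctor.Linear k]
  [isEquivalence : toFunctor.IsEquivalence]

namespace TensorAut

attribute [instance] TensorAut.monoidal TensorAut.additive TensorAut.linear
  TensorAut.isEquivalence

variable {k : Type*} [Field k] {C : Type*} [Category C] [Preadditive C] [Linear k C]
    [MonoidalCategory C]

/-- Arrows of `Aut_⊗(C)`: monoidal natural isomorphisms. -/
@[ext]
structure Hom (F G : TensorAut k C) where
  iso : F.toFunctor ≅ G.toFunctor
  [isMonoidal : NatTrans.IsMonoidal iso.hom]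

attribute [instance] Hom.isMonoidal

instance : Category (TensorAut k C) where
  Hom := Hom
  id F := { iso := Iso.refl F.toFunctor
            isMonoidal := inferInstanceAs (NatTrans.IsMonoidal (𝟙 F.toFunctor)) }
  comp f g :=
    { iso := f.iso ≪≫ g.iso
      isMonoidal := inferInstanceAs (NatTrans.IsMonoidal (f.iso.hom ≫ g.iso.hom)) }
  id_comp f := Hom.ext (Iso.refl_trans f.iso)
  comp_id f := Hom.ext (Iso.trans_refl f.iso)
  assoc f g h := Hom.ext (Iso.trans_assoc f.iso g.iso h.iso)

/-- The component at `X` of an arrow of `Aut_⊗(C)`. -/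
def Hom.app {F G : TensorAut k C} (f : F ⟶ G) (X : C) :
    F.toFunctor.obj X ⟶ G.toFunctor.obj X := f.iso.hom.app X

theorem hom_ext {F G : TensorAut k C} {f g : F ⟶ G}
    (h : ∀ X, Hom.app f X = Hom.app g X) : f = g :=
  Hom.ext (Iso.ext (NatTrans.ext (funext h)))

@[simp] theorem id_app (F : TensorAut k C) (X : C) :
    Hom.app (𝟙 F) X = 𝟙 (F.toFunctor.obj X) := rfl

@[simp] theorem comp_app {F G H : TensorAut k C} (f : F ⟶ G) (g : G ⟶ H) (X : C) :
    Hom.app (f ≫ g) X = Hom.app f X ≫ Hom.app g X := rfl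

theorem app_naturality {F G : TensorAut k C} (f : F ⟶ G) {X Y : C} (u : X ⟶ Y) :
    F.toFunctor.map u ≫ Hom.app f Y = Hom.app f X ≫ G.toFunctor.map u :=
  f.iso.hom.naturality u

/-- The identity functor. -/
def one : TensorAut k C where
  toFunctor := 𝟭 C

/-- `F ⊗ G := F ∘ G`, i.e. `X ↦ F (G X)`. -/
def mul (F G : TensorAut k C) : TensorAut k C where
  toFunctor := G.toFunctor ⋙ F.toFunctor

/-- An arrow of `Aut_⊗(C)` from a monoidal natural isomorphism. -/
def homMk {F G : TensorAut k C} (e : F.toFunctor ≅ G.toFunctor)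
    (h : NatTrans.IsMonoidal e.hom) : F ⟶ G :=
  { iso := e, isMonoidal := h }

/-- A monoidal natural isomorphism is an isomorphism in `Aut_⊗(C)`. -/
def isoMk {F G : TensorAut k C} (e : F.toFunctor ≅ G.toFunctor)
    (h : NatTrans.IsMonoidal e.hom) : F ≅ G where
  hom := { iso := e, isMonoidal := h }
  inv := { iso := e.symm, isMonoidal := inferInstanceAs (NatTrans.IsMonoidal e.inv) }
  hom_inv_id := Hom.ext (Iso.self_symm_id e)
  inv_hom_id := Hom.ext (Iso.symm_self_id e)

/-- The monoidal structure on `Aut_⊗(C)`: the tensor product is composition of functors, with the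
identity functor as unit and horizontal composition on arrows; all constraints have identity
components. -/
instance : MonoidalCategoryStruct (TensorAut k C) where
  tensorObj F G := mul F G
  tensorUnit := one
  whiskerLeft F _ _ g := homMk (F := mul F _) (G := mul F _)
    (Functor.isoWhiskerRight g.iso F.toFunctor)
    (inferInstanceAs (NatTrans.IsMonoidal (Functor.whiskerRight g.iso.hom F.toFunctor)))
  whiskerRight f G := homMk (F := mul _ G) (G := mul _ G)
    (Functor.isoWhiskerLeft G.toFunctor f.iso)
    (inferInstanceAs (NatTrans.IsMonoidal (Functor.whiskerLeft G.toFunctor f.iso.hom)))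
  tensorHom {F₁ F₂ G₁ G₂} f g := homMk (F := mul F₁ G₁) (G := mul F₂ G₂)
    (NatIso.hcomp g.iso f.iso)
    (inferInstanceAs (NatTrans.IsMonoidal (g.iso.hom ◫ f.iso.hom)))
  associator F G H := isoMk (F := mul (mul F G) H) (G := mul F (mul G H))
    (Functor.associator H.toFunctor G.toFunctor F.toFunctor).symm
    (inferInstanceAs (NatTrans.IsMonoidal
      (Functor.associator H.toFunctor G.toFunctor F.toFunctor).inv))
  leftUnitor F := isoMk (F := mul one F) (G := F) F.toFunctor.rightUnitor
    (inferInstanceAs (NatTrans.IsMonoidal F.toFunctor.rightUnitor.hom))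
  rightUnitor F := isoMk (F := mul F one) (G := F) F.toFunctor.leftUnitor
    (inferInstanceAs (NatTrans.IsMonoidal F.toFunctor.leftUnitor.hom))

instance : MonoidalCategory (TensorAut k C) where
  tensorHom_def f g := hom_ext fun X => rfl
  id_tensorHom_id F G := hom_ext fun X => by
    change 𝟙 _ ≫ F.toFunctor.map (𝟙 (G.toFunctor.obj X)) = 𝟙 _
    simp
  tensorHom_comp_tensorHom {F₁ F₂ F₃ G₁ G₂ G₃} f g f' g' := hom_ext fun X => by
    change (Hom.app f (G₁.toFunctor.obj X) ≫ F₂.toFunctor.map (Hom.app g X)) ≫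
        Hom.app f' (G₂.toFunctor.obj X) ≫ F₃.toFunctor.map (Hom.app g' X) =
      (Hom.app f (G₁.toFunctor.obj X) ≫ Hom.app f' (G₁.toFunctor.obj X)) ≫
        F₃.toFunctor.map (Hom.app g X ≫ Hom.app g' X)
    simp only [Category.assoc, Functor.map_comp]
    rw [reassoc_of% (app_naturality f' (Hom.app g X))]
  whiskerLeft_id F G := hom_ext fun X => F.toFunctor.map_id (G.toFunctor.obj X)
  id_whiskerRight F G := rfl
  associator_naturality {F₁ F₂ F₃ G₁ G₂ G₃} f g h := hom_ext fun X => by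
    change ((Hom.app f (F₂.toFunctor.obj (F₃.toFunctor.obj X)) ≫
        G₁.toFunctor.map (Hom.app g (F₃.toFunctor.obj X))) ≫
          G₁.toFunctor.map (G₂.toFunctor.map (Hom.app h X))) ≫ 𝟙 _ =
      𝟙 _ ≫ Hom.app f (F₂.toFunctor.obj (F₃.toFunctor.obj X)) ≫
        G₁.toFunctor.map (Hom.app g (F₃.toFunctor.obj X) ≫ G₂.toFunctor.map (Hom.app h X))
    simp
  leftUnitor_naturality f := hom_ext fun X => by
    change Hom.app f X ≫ 𝟙 _ = 𝟙 _ ≫ Hom.app f X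
    simp
  rightUnitor_naturality f := hom_ext fun X => by
    change Hom.app f X ≫ 𝟙 _ = 𝟙 _ ≫ Hom.app f X
    simp
  pentagon F G H K := hom_ext fun X => by
    change 𝟙 _ ≫ 𝟙 _ ≫ F.toFunctor.map (𝟙 _) = 𝟙 _ ≫ 𝟙 _
    simp
  triangle F G := hom_ext fun X => by
    change 𝟙 _ ≫ F.toFunctor.map (𝟙 _) = 𝟙 _
    simp

end TensorAut

/-! ### Tensor powers and cyclic pairs in a monoidal category -/

section Cyclic

variable {D : Type*} [Category D] [MonoidalCategory D]

/-- Tensor powers: `X^0 = 𝟙`, `X^(n+1) = X^n ⊗ X`. -/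
abbrev tpow (X : D) : ℕ → D
  | 0 => 𝟙_ D
  | n + 1 => tpow X n ⊗ X

/-- Tensor powers of an arrow. -/
def tpowMap {X Y : D} (f : X ⟶ Y) : (n : ℕ) → (tpow X n ⟶ tpow Y n)
  | 0 => 𝟙 (𝟙_ D)
  | n + 1 => tpowMap f n ⊗ₘ f

/-- The canonical isomorphism `X^i ⊗ X^j ≅ X^(i+j)`, built from the constraints of `D`. -/
def tpowAdd (X : D) (i : ℕ) : (j : ℕ) → (tpow X i ⊗ tpow X j ≅ tpow X (i + j))
  | 0 => ρ_ (tpow X i)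
  | j + 1 => (α_ (tpow X i) (tpow X j) X).symm ≪≫ whiskerRightIso (tpowAdd X i j) X

/-- The canonical isomorphism `X ⊗ X^n ≅ X^n ⊗ X`, built from the constraints of `D`. -/
def tpowComm (X : D) : (n : ℕ) → (X ⊗ tpow X n ≅ tpow X n ⊗ X)
  | 0 => ρ_ X ≪≫ (λ_ X).symm
  | n + 1 => (α_ X (tpow X n) X).symm ≪≫ whiskerRightIso (tpowComm X n) X

/-- Transport of tensor powers along an equality of exponents. -/
def tpowCast (X : D) {a b : ℕ} (h : a = b) : tpow X a ≅ tpow X b :=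
  eqToIso (congrArg (tpow X) h)

variable (D) in
/-- A pair `(X, α)` with `α : X^m ≅ 𝟙` and `id_X ⊗ α = α ⊗ id_X` (modulo the constraints
`X ⊗ X^m ≅ X^m ⊗ X`, `X ⊗ 𝟙 ≅ X` and `𝟙 ⊗ X ≅ X`). -/
structure CyclicPair (m : ℕ) where
  X : D
  α : tpow X m ≅ 𝟙_ D
  comm : X ◁ α.hom ≫ (ρ_ X).hom = (tpowComm X m).hom ≫ α.hom ▷ X ≫ (λ_ X).hom

namespace CyclicPair

/-- Two pairs are equivalent if there is an isomorphism `θ : X₁ ≅ X₂` with `α₂ ∘ θ^m = α₁`. -/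
def Equivalent {m : ℕ} (P Q : CyclicPair D m) : Prop :=
  ∃ θ : P.X ≅ Q.X, tpowMap θ.hom m ≫ Q.α.hom = P.α.hom

/-- `id ⊗ α : X^(n+m) ≅ X^n ⊗ X^m ≅ X^n ⊗ 𝟙 ≅ X^n`. -/
def drop {m : ℕ} (P : CyclicPair D m) {a b : ℕ} (h : a = b + m) : tpow P.X a ≅ tpow P.X b :=
  tpowCast P.X h ≪≫ (tpowAdd P.X b m).symm ≪≫ whiskerLeftIso (tpow P.X b) P.α ≪≫ ρ_ (tpow P.X b)

/-- The tensor structure `φ(σ^i, σ^j) : X^i ⊗ X^j ≅ X^(i+j mod m)` for `0 ≤ i, j < m`: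
the canonical isomorphism if `i + j < m`, and the canonical isomorphism followed by
`id ⊗ α : X^(i+j) ≅ X^(i+j-m)` if `i + j ≥ m`. -/
def phi {m : ℕ} [NeZero m] (P : CyclicPair D m) (i j : ZMod m) :
    tpow P.X i.val ⊗ tpow P.X j.val ≅ tpow P.X (i + j).val :=
  if h : i.val + j.val < m then
    tpowAdd P.X i.val j.val ≪≫ tpowCast P.X (ZMod.val_add_of_lt h).symm
  else
    tpowAdd P.X i.val j.val ≪≫
      P.drop (by rw [ZMod.val_add_of_le (not_lt.mp h)]; omega)

end CyclicPair

@[simp] theorem tpowCast_rfl (X : D) (a : ℕ) (h : a = a) : tpowCast X h = Iso.refl _ := rfl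

theorem tpowAdd_succ_hom (X : D) (i j : ℕ) : (tpowAdd X i (j + 1)).hom =
    (α_ (tpow X i) (tpow X j) X).inv ≫ (tpowAdd X i j).hom ▷ X := rfl

theorem tpowCast_whiskerRight (X : D) {a b : ℕ} (h : a = b) :
    (tpowCast X h).hom ▷ X = (tpowCast X (congrArg (· + 1) h)).hom := by
  subst h; simp

theorem tpowAdd_assoc (X : D) (i j k : ℕ) :
    (tpowAdd X i j).hom ▷ tpow X k ≫ (tpowAdd X (i + j) k).hom ≫
      (tpowCast X (add_assoc i j k)).hom =
    (α_ _ _ _).hom ≫ tpow X i ◁ (tpowAdd X j k).hom ≫ (tpowAdd X i (j + k)).hom := by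
  induction k with
  | zero => simp [tpowAdd, tpow]
  | succ k ih =>
    have e := tpowCast_whiskerRight X (add_assoc i j k)
    have h1 : (tpowAdd X i (j + (k + 1))).hom =
      (α_ (tpow X i) (tpow X (j + k)) X).inv ≫ (tpowAdd X i (j + k)).hom ▷ X := rfl
    have h2 : (tpowCast X (add_assoc i j (k+1))).hom =
      (tpowCast X (add_assoc i j k)).hom ▷ X := e.symm
    have ih' := congrArg (fun f => f ▷ X) ih
    simp only [comp_whiskerRight] at ih'
    rw [h1, h2, tpowAdd_succ_hom, tpowAdd_succ_hom]
    simp only [tpow, Category.assoc, MonoidalCategory.whiskerLeft_comp]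
    rw [← cancel_epi (α_ (tpow X i ⊗ tpow X j) (tpow X k) X).hom]
    have n1 : (tpowAdd X i j).hom ▷ (tpow X k ⊗ X) ≫ (α_ (tpow X (i+j)) (tpow X k) X).inv =
      (α_ _ _ _).inv ≫ ((tpowAdd X i j).hom ▷ tpow X k) ▷ X := by simp
    have n2 : tpow X i ◁ ((tpowAdd X j k).hom ▷ X) ≫ (α_ _ _ _).inv = 
      (α_ _ _ _).inv ≫ (tpow X i ◁ (tpowAdd X j k).hom) ▷ X := by simp
    rw [reassoc_of% n1, Iso.hom_inv_id_assoc, ih', reassoc_of% n2]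
    simp

theorem tpowAdd_zero_left (X : D) (n : ℕ) :
    (tpowAdd X 0 n).hom ≫ (tpowCast X (zero_add n)).hom = (λ_ (tpow X n)).hom := by
  induction n with
  | zero => simp [tpowAdd, tpow, unitors_equal]
  | succ n ih =>
    have h2 : (tpowCast X (zero_add (n+1))).hom =
      (tpowCast X (zero_add n)).hom ▷ X := (tpowCast_whiskerRight X _).symm
    have ih' := congrArg (fun f => f ▷ X) ih
    simp only [comp_whiskerRight] at ih'
    rw [h2, tpowAdd_succ_hom, Category.assoc, ih']
    simp [tpow]

theorem tpowAdd_succ_left (X : D) (n j : ℕ) :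
    (tpowAdd X (n + 1) j).hom ≫ (tpowCast X (Nat.succ_add n j)).hom =
      (α_ (tpow X n) X (tpow X j)).hom ≫ tpow X n ◁ (tpowComm X j).hom ≫
        (α_ _ _ _).inv ≫ (tpowAdd X n j).hom ▷ X := by
  induction j with
  | zero => simp [tpowAdd, tpowComm, tpow]
  | succ j ih =>
    have h2 : (tpowCast X (Nat.succ_add n (j+1))).hom =
      (tpowCast X (Nat.succ_add n j)).hom ▷ X := (tpowCast_whiskerRight X _).symm
    have ih' := congrArg (fun f => f ▷ X) ih
    simp only [comp_whiskerRight] at ih'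
    rw [h2, tpowAdd_succ_hom, Category.assoc, ih', tpowAdd_succ_hom]
    simp [tpow, tpowComm]

namespace CyclicPair

variable {m : ℕ} (P : CyclicPair D m)

theorem tpowAdd_drop (b : ℕ) :
    (tpowAdd P.X b m).hom ≫ (P.drop (rfl : b + m = b + m)).hom =
      tpow P.X b ◁ P.α.hom ≫ (ρ_ _).hom := by
  simp [drop]

theorem drop_eq {a b : ℕ} (h : a = b + m) :
    (P.drop h).hom = (tpowCast P.X h).hom ≫ (P.drop (rfl : b + m = b + m)).hom := by
  subst h; simp

theorem drop_whiskerRight_one (n : ℕ) :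
    (tpowCast P.X (Nat.succ_add n m)).hom ≫ (P.drop (rfl : n + m = n + m)).hom ▷ P.X =
      (P.drop (rfl : n + 1 + m = n + 1 + m)).hom := by
  have key := tpowAdd_succ_left P.X n m
  rw [← cancel_epi (tpowAdd P.X (n + 1) m).hom, tpowAdd_drop, reassoc_of% key,
    ← comp_whiskerRight, tpowAdd_drop]
  have c := congrArg (fun f => tpow P.X n ◁ f) P.comm
  simp only [MonoidalCategory.whiskerLeft_comp] at c
  have e : tpow P.X (n + 1) ◁ P.α.hom ≫ (ρ_ (tpow P.X (n + 1))).hom =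
      (α_ (tpow P.X n) P.X (tpow P.X m)).hom ≫ tpow P.X n ◁ P.X ◁ P.α.hom ≫
        tpow P.X n ◁ (ρ_ P.X).hom := by simp
  rw [e, c]
  simp

theorem drop_tpowAdd (n k : ℕ) :
    (P.drop (rfl : n + m = n + m)).hom ▷ tpow P.X k ≫ (tpowAdd P.X n k).hom =
      (tpowAdd P.X (n + m) k).hom ≫ (P.drop (Nat.add_right_comm n m k)).hom := by
  induction k with
  | zero => simp [tpowAdd]
  | succ k ih =>
    have ih' := congrArg (fun f => f ▷ P.X) ih
    simp only [comp_whiskerRight] at ih'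
    have e := P.drop_whiskerRight_one (n + k)
    have n1 : (P.drop (rfl : n + m = n + m)).hom ▷ (tpow P.X k ⊗ P.X) ≫
        (α_ (tpow P.X n) (tpow P.X k) P.X).inv =
      (α_ _ _ _).inv ≫ ((P.drop (rfl : n + m = n + m)).hom ▷ tpow P.X k) ▷ P.X := by simp
    rw [tpowAdd_succ_hom, tpowAdd_succ_hom, reassoc_of% n1, ih', Category.assoc,
      P.drop_eq (Nat.add_right_comm n m (k + 1))]
    erw [← e]
    rw [P.drop_eq (Nat.add_right_comm n m k), comp_whiskerRight, tpowCast_whiskerRight]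
    simp [tpowCast]

theorem tpowAdd_drop_left (i b : ℕ) :
    tpow P.X i ◁ (P.drop (rfl : b + m = b + m)).hom ≫ (tpowAdd P.X i b).hom =
      (tpowAdd P.X i (b + m)).hom ≫ (P.drop (Nat.add_assoc i b m).symm).hom := by
  have a := tpowAdd_assoc P.X i b m
  rw [← cancel_epi (tpow P.X i ◁ (tpowAdd P.X b m).hom),
    ← MonoidalCategory.whiskerLeft_comp_assoc, tpowAdd_drop,
    ← cancel_epi (α_ _ _ _).hom, ← reassoc_of% a, P.drop_eq]
  have c : (tpowCast P.X (add_assoc i b m)).hom ≫ (tpowCast P.X (add_assoc i b m).symm).hom =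
    𝟙 _ := by simp [tpowCast]
  rw [reassoc_of% c, tpowAdd_drop, ← whisker_exchange_assoc]
  simp

/-- Iterated `drop`. -/
def dropPow : (q : ℕ) → {a b : ℕ} → a = b + q * m → (tpow P.X a ⟶ tpow P.X b)
  | 0, _, _, h => (tpowCast P.X (by simpa using h)).hom
  | q + 1, _, b, h => (P.drop (b := b + q * m) (by rw [h]; ring)).hom ≫ dropPow q rfl

theorem dropPow_zero {a b : ℕ} (h : a = b) (h' : a = b + 0 * m) :
    P.dropPow 0 h' = (tpowCast P.X h).hom := rfl

theorem dropPow_succ (q : ℕ) {a a' b : ℕ} (h : a = a' + m) (h' : a' = b + q * m)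
    (h'' : a = b + (q + 1) * m) :
    P.dropPow (q + 1) h'' = (P.drop h).hom ≫ P.dropPow q h' := by
  subst h'; rfl

theorem dropPow_comp (q q' : ℕ) {a b c : ℕ} (h : a = b + q * m) (h' : b = c + q' * m)
    (h'' : a = c + (q' + q) * m) :
    P.dropPow q h ≫ P.dropPow q' h' = P.dropPow (q' + q) h'' := by
  induction q generalizing a with
  | zero =>
    have : a = b := by simpa using h
    subst this
    rw [P.dropPow_zero rfl h]
    simp
  | succ q ih =>
    have h1 : a = (b + q * m) + m := by rw [h]; ring
    have h2 : b + q * m = c + (q' + q) * m := by rw [h']; ring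
    change _ = P.dropPow (q' + q + 1) h''
    rw [P.dropPow_succ q h1 rfl, P.dropPow_succ (q' + q) h1 h2, Category.assoc, ih rfl h2]

theorem dropPow_tpowAdd (q : ℕ) {n n' : ℕ} (k : ℕ) (h : n = n' + q * m)
    (h' : n + k = n' + k + q * m) :
    P.dropPow q h ▷ tpow P.X k ≫ (tpowAdd P.X n' k).hom =
      (tpowAdd P.X n k).hom ≫ P.dropPow q h' := by
  induction q generalizing n with
  | zero =>
    have : n = n' := by simpa using h
    subst this
    rw [P.dropPow_zero rfl h, P.dropPow_zero rfl h']
    simp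
  | succ q ih =>
    have h1 : n = (n' + q * m) + m := by rw [h]; ring
    have h2 : n' + q * m + k = n' + k + q * m := by ring
    subst h1
    rw [P.dropPow_succ q rfl rfl, P.dropPow_succ q (Nat.add_right_comm _ m k) h2,
      comp_whiskerRight, Category.assoc, ih rfl h2, ← Category.assoc, drop_tpowAdd,
      Category.assoc]

theorem tpowAdd_dropPow (q : ℕ) {n n' : ℕ} (i : ℕ) (h : n = n' + q * m)
    (h' : i + n = i + n' + q * m) :
    tpow P.X i ◁ P.dropPow q h ≫ (tpowAdd P.X i n').hom =
      (tpowAdd P.X i n).hom ≫ P.dropPow q h' := by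
  induction q generalizing n with
  | zero =>
    have : n = n' := by simpa using h
    subst this
    rw [P.dropPow_zero rfl h, P.dropPow_zero rfl h']
    simp
  | succ q ih =>
    have h1 : n = (n' + q * m) + m := by rw [h]; ring
    have h2 : i + (n' + q * m) = i + n' + q * m := by ring
    subst h1
    rw [P.dropPow_succ q rfl rfl, P.dropPow_succ q (Nat.add_assoc _ _ m).symm h2,
      MonoidalCategory.whiskerLeft_comp, Category.assoc, ih rfl h2, ← Category.assoc,
      tpowAdd_drop_left, Category.assoc]

theorem exists_phi_eq [NeZero m] (i j : ZMod m) :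
    ∃ (q : ℕ) (h : i.val + j.val = (i + j).val + q * m),
      (P.phi i j).hom = (tpowAdd P.X i.val j.val).hom ≫ P.dropPow q h := by
  by_cases h : i.val + j.val < m
  · refine ⟨0, by simp [ZMod.val_add_of_lt h], ?_⟩
    simp only [phi, dif_pos h]
    rfl
  · have h1 : i.val + j.val = (i + j).val + m := by
      rw [ZMod.val_add_of_le (not_lt.mp h)]; omega
    refine ⟨1, by rw [one_mul]; exact h1, ?_⟩
    simp only [phi, dif_neg h]
    rw [P.dropPow_succ 0 h1 (by simp), P.dropPow_zero rfl]
    simp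

theorem phi_assoc [NeZero m] (i j k : ZMod m) :
    (P.phi i j).hom ▷ tpow P.X k.val ≫ (P.phi (i + j) k).hom ≫
      (tpowCast P.X (congrArg ZMod.val (add_assoc i j k))).hom =
    (α_ _ _ _).hom ≫ tpow P.X i.val ◁ (P.phi j k).hom ≫ (P.phi i (j + k)).hom := by
  obtain ⟨q₁, h₁, e₁⟩ := P.exists_phi_eq i j
  obtain ⟨q₂, h₂, e₂⟩ := P.exists_phi_eq (i + j) k
  obtain ⟨q₃, h₃, e₃⟩ := P.exists_phi_eq j k
  obtain ⟨q₄, h₄, e₄⟩ := P.exists_phi_eq i (j + k)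
  have hv : (i + j + k).val = (i + (j + k)).val := congrArg ZMod.val (add_assoc i j k)
  have hq : q₂ + q₁ = q₄ + q₃ := by
    have : (q₂ + q₁) * m = (q₄ + q₃) * m := by
      rw [add_mul, add_mul]; omega
    exact Nat.eq_of_mul_eq_mul_right (NeZero.pos m) this
  have f₁ : i.val + j.val + k.val = (i + j).val + k.val + q₁ * m := by omega
  have f₃ : i.val + (j.val + k.val) = i.val + (j + k).val + q₃ * m := by omega
  have g : i.val + j.val + k.val = (i + j + k).val + (q₂ + q₁) * m := by
    rw [add_mul]; omega
  have g' : i.val + (j.val + k.val) = (i + (j + k)).val + (q₄ + q₃) * m := by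
    rw [add_mul]; omega
  have a := tpowAdd_assoc P.X i.val j.val k.val
  rw [e₁, e₂, e₃, e₄, comp_whiskerRight, MonoidalCategory.whiskerLeft_comp]
  simp only [Category.assoc]
  rw [← Category.assoc (P.dropPow q₁ h₁ ▷ _), P.dropPow_tpowAdd q₁ _ h₁ f₁,
    ← Category.assoc (_ ◁ P.dropPow q₃ h₃), P.tpowAdd_dropPow q₃ _ h₃ f₃]
  simp only [Category.assoc]
  rw [← reassoc_of% a, P.dropPow_comp q₃ q₄ f₃ h₄ g', ← Category.assoc (P.dropPow q₁ f₁),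
    P.dropPow_comp q₁ q₂ f₁ h₂ g]
  congr 2
  generalize q₂ + q₁ = q at *
  subst hq
  rw [← P.dropPow_zero (add_assoc i.val j.val k.val) (by omega), ← P.dropPow_zero hv (by omega),
    P.dropPow_comp _ _ _ _ (by rw [← hv, zero_add]; exact g),
    P.dropPow_comp _ _ _ _ (by rw [← hv, add_zero]; exact g)]
  congr 1
  omega

theorem phi_zero_left [NeZero m] (i : ZMod m) :
    (P.phi 0 i).hom ≫ (tpowCast P.X (congrArg ZMod.val (zero_add i))).hom =
      (tpowCast P.X ZMod.val_zero).hom ▷ tpow P.X i.val ≫ (λ_ (tpow P.X i.val)).hom := by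
  obtain ⟨q, h, e⟩ := P.exists_phi_eq 0 i
  have hi : (0 + i).val = i.val := congrArg ZMod.val (zero_add i)
  have h0 : (0 : ZMod m).val = 0 := ZMod.val_zero
  have hq : q = 0 := by
    have : q * m = 0 := by omega
    exact (Nat.mul_eq_zero.mp this).resolve_right (NeZero.ne m)
  subst hq
  have h' : (0 : ZMod m).val + i.val = (0 + i).val := by omega
  rw [e, P.dropPow_zero h']
  have gen : ∀ (a b : ℕ) (h0 : a = 0) (h' : a + i.val = b) (hi : b = i.val),
      ((tpowAdd P.X a i.val).hom ≫ (tpowCast P.X h').hom) ≫ (tpowCast P.X hi).hom =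
        (tpowCast P.X h0).hom ▷ tpow P.X i.val ≫ (λ_ (tpow P.X i.val)).hom := by
    intro a b h0 h' hi
    subst h0 h'
    simpa using tpowAdd_zero_left P.X i.val
  exact gen _ _ h0 h' hi

theorem phi_zero_right [NeZero m] (i : ZMod m) :
    (P.phi i 0).hom ≫ (tpowCast P.X (congrArg ZMod.val (add_zero i))).hom =
      tpow P.X i.val ◁ (tpowCast P.X ZMod.val_zero).hom ≫ (ρ_ (tpow P.X i.val)).hom := by
  obtain ⟨q, h, e⟩ := P.exists_phi_eq i 0
  have hi : (i + 0).val = i.val := congrArg ZMod.val (add_zero i)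
  have h0 : (0 : ZMod m).val = 0 := ZMod.val_zero
  have hq : q = 0 := by
    have : q * m = 0 := by omega
    exact (Nat.mul_eq_zero.mp this).resolve_right (NeZero.ne m)
  subst hq
  have h' : i.val + (0 : ZMod m).val = (i + 0).val := by omega
  rw [e, P.dropPow_zero h']
  have gen : ∀ (a b : ℕ) (h0 : a = 0) (h' : i.val + a = b) (hi : b = i.val),
      ((tpowAdd P.X i.val a).hom ≫ (tpowCast P.X h').hom) ≫ (tpowCast P.X hi).hom =
        tpow P.X i.val ◁ (tpowCast P.X h0).hom ≫ (ρ_ (tpow P.X i.val)).hom := by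
    intro a b h0 h' hi
    subst h0 h'
    simp [tpowAdd]
  exact gen _ _ h0 h' hi

/-- The functor `σ^i ↦ X^i`, `0 ≤ i < m`, on the discrete category of the cyclic group
`C_m = ⟨σ⟩`, realized as `Multiplicative (ZMod m)` with `σ = ofAdd 1`. -/
def functor [NeZero m] : Discrete (Multiplicative (ZMod m)) ⥤ D :=
  Discrete.functor fun g => tpow P.X g.toAdd.val

theorem functor_map [NeZero m] {x y : Discrete (Multiplicative (ZMod m))} (f : x ⟶ y) :
    P.functor.map f =
      (tpowCast P.X (congrArg (fun g => (Multiplicative.toAdd g).val)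
        (Discrete.eq_of_hom f))).hom := by
  obtain ⟨x⟩ := x
  obtain ⟨y⟩ := y
  obtain rfl : x = y := Discrete.eq_of_hom f
  obtain rfl : f = 𝟙 _ := Subsingleton.elim _ _
  simp
  rfl

/-- The monoidal structure on `σ^i ↦ X^i` with tensor structure `phi` and unit structure the
identity of `X^0 = 𝟙`. -/
def coreMonoidal [NeZero m] : P.functor.CoreMonoidal where
  εIso := (tpowCast P.X (ZMod.val_zero (n := m))).symm
  μIso x y := P.phi x.as.toAdd y.as.toAdd
  μIso_hom_natural_left {x y} f z := by
    obtain ⟨x⟩ := x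
    obtain ⟨y⟩ := y
    obtain rfl : x = y := Discrete.eq_of_hom f
    obtain rfl : f = 𝟙 _ := Subsingleton.elim _ _
    simp
  μIso_hom_natural_right {x y} z f := by
    obtain ⟨x⟩ := x
    obtain ⟨y⟩ := y
    obtain rfl : x = y := Discrete.eq_of_hom f
    obtain rfl : f = 𝟙 _ := Subsingleton.elim _ _
    simp
  associativity x y z := by
    rw [functor_map]
    exact P.phi_assoc x.as.toAdd y.as.toAdd z.as.toAdd
  left_unitality x := by
    rw [functor_map]
    have h := P.phi_zero_left x.as.toAdd
    refine Eq.trans ?_ (congrArg (fun f => (tpowCast P.X (ZMod.val_zero (n := m))).inv ▷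
      tpow P.X x.as.toAdd.val ≫ f) h).symm
    simp
    rfl
  right_unitality x := by
    rw [functor_map]
    have h := P.phi_zero_right x.as.toAdd
    refine Eq.trans ?_ (congrArg (fun f => tpow P.X x.as.toAdd.val ◁
      (tpowCast P.X (ZMod.val_zero (n := m))).inv ≫ f) h).symm
    simp [functor]

instance [NeZero m] : P.functor.Monoidal := P.coreMonoidal.toMonoidal

end CyclicPair

end Cyclic

/-! ### Group actions on tensor categories -/

/-- An action of the group `G` on the tensor category `C`: a monoidal functor from the discrete
monoidal category `Discrete G` (objects the elements of `G`, only identity arrows, tensor product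
the multiplication of `G`) to the monoidal category `Aut_⊗(C)` of tensor autoequivalences. -/
structure TensorAction (k : Type*) [Field k] (C : Type*) [Category C] [Preadditive C] [Linear k C]
    [MonoidalCategory C] (G : Type*) [Group G] where
  toFunctor : Discrete G ⥤ TensorAut k C
  [monoidal : toFunctor.Monoidal]

attribute [instance] TensorAction.monoidal

namespace TensorAction

variable {k : Type*} [Field k] {C : Type*} [Category C] [Preadditive C] [Linear k C]
    [MonoidalCategory C]

/-- Equivalence of actions: existence of a monoidal natural isomorphism of monoidal functors. -/
def Equivalent {G : Type*} [Group G] (S T : TensorAction k C G) : Prop :=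
  ∃ e : S.toFunctor ≅ T.toFunctor, NatTrans.IsMonoidal e.hom

/-- The `C_m`-action induced by a pair `(F, α)`: `σ^i ↦ F^i` for `0 ≤ i < m`, with
`F^i ∘ F^j ≅ F^(i+j mod m)` the canonical identification if `i + j < m` and given by `α`
if `i + j ≥ m`. -/
def ofPair {m : ℕ} [NeZero m] (P : CyclicPair (TensorAut k C) m) :
    TensorAction k C (Multiplicative (ZMod m)) where
  toFunctor := P.functor

end TensorAction

/-! The argument lives in an arbitrary monoidal category `D`, specialised to `TensorAut k C` at the
end. Let `σ` be the generator of the cyclic group.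

From functors to pairs: a monoidal functor `T` on `Discrete G` and an element `s` with `s ^ m = 1`
give `X = T s` and `α : X^m ≅ T (s^m) = T 1 ≅ 𝟙` (`ofFunctor`). Since `s * s^m` and `s^m * s` are
the same element, the coherence of `T` forces `α` to commute with `X` (`tpowComm_tpowDiscrete`). A
monoidal isomorphism of functors, evaluated at `s`, is an equivalence of pairs
(`ofFunctor_equivalent`).

From pairs to functors: an equivalence `θ` from `P` to the pair of `T` at `σ` extends to a monoidal
isomorphism `P.functor ≅ T` with components `X^i → (T σ)^i ≅ T (σ^i)` (`exists_functor_iso`). The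
point is that removing a block `X^m` by `α` corresponds to `σ^m = 1` (`drop_toDiscrete`). Taking `θ`
to be the identity gives claim 1.

Finally, `P` is recovered from its own functor (`equivalent_ofFunctor_functor`): the maps involved
are iterated drops `X^n → X^(n mod m)`, which are determined by how many blocks are removed. Claim 2
and the bijection are then formal. -/

section DiscreteFunctor

/-! ### Monoidal functors on a discrete monoidal category, and powers of their values. -/

variable {D : Type*} [Category D] {G : Type*}

/-- The isomorphism `T a ≅ T b` given by an equality `a = b`. -/
def discreteCast (T : Discrete G ⥤ D) {a b : G} (h : a = b) : T.obj ⟨a⟩ ≅ T.obj ⟨b⟩ :=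
  T.mapIso (eqToIso (congrArg Discrete.mk h))

@[simp] theorem discreteCast_rfl (T : Discrete G ⥤ D) {a : G} (h : a = a) :
    discreteCast T h = Iso.refl _ := by
  simp [discreteCast]

@[simp] theorem discreteCast_trans (T : Discrete G ⥤ D) {a b c : G} (h : a = b) (h' : b = c) :
    (discreteCast T h).hom ≫ (discreteCast T h').hom = (discreteCast T (h.trans h')).hom := by
  subst h h'; simp

@[simp] theorem discreteCast_trans_assoc (T : Discrete G ⥤ D) {a b c : G} (h : a = b) (h' : b = c)
    {Z : D} (f : T.obj ⟨c⟩ ⟶ Z) :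
    (discreteCast T h).hom ≫ (discreteCast T h').hom ≫ f =
      (discreteCast T (h.trans h')).hom ≫ f := by
  rw [← Category.assoc, discreteCast_trans]

theorem discreteCast_naturality {S T : Discrete G ⥤ D} (e : S ⟶ T) {a b : G} (h : a = b) :
    (discreteCast S h).hom ≫ e.app ⟨b⟩ = e.app ⟨a⟩ ≫ (discreteCast T h).hom := by
  subst h; simp

variable [MonoidalCategory D] [Monoid G] (T : Discrete G ⥤ D) [T.Monoidal]

/-- The tensor constraint `T a ⊗ T b ≅ T (a * b)`. -/
def discreteMul (a b : G) : T.obj ⟨a⟩ ⊗ T.obj ⟨b⟩ ≅ T.obj ⟨a * b⟩ :=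
  Functor.Monoidal.μIso T ⟨a⟩ ⟨b⟩

/-- The unit constraint `𝟙 ≅ T 1`. -/
def discreteOne : 𝟙_ D ≅ T.obj ⟨(1 : G)⟩ := Functor.Monoidal.εIso T

theorem discreteMul_assoc (a b c : G) :
    (discreteMul T a b).hom ▷ T.obj ⟨c⟩ ≫ (discreteMul T (a * b) c).hom ≫
      (discreteCast T (mul_assoc a b c)).hom =
    (α_ _ _ _).hom ≫ T.obj ⟨a⟩ ◁ (discreteMul T b c).hom ≫ (discreteMul T a (b * c)).hom :=
  Functor.LaxMonoidal.associativity T ⟨a⟩ ⟨b⟩ ⟨c⟩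

theorem discreteOne_mul (a : G) :
    (discreteOne T).hom ▷ T.obj ⟨a⟩ ≫ (discreteMul T 1 a).hom ≫
      (discreteCast T (one_mul a)).hom = (λ_ (T.obj ⟨a⟩)).hom :=
  (Functor.LaxMonoidal.left_unitality T ⟨a⟩).symm

theorem discreteMul_one (a : G) :
    T.obj ⟨a⟩ ◁ (discreteOne T).hom ≫ (discreteMul T a 1).hom ≫
      (discreteCast T (mul_one a)).hom = (ρ_ (T.obj ⟨a⟩)).hom :=
  (Functor.LaxMonoidal.right_unitality T ⟨a⟩).symm

theorem discreteCast_mul {a a' b b' : G} (h : a = a') (h' : b = b') :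
    ((discreteCast T h).hom ⊗ₘ (discreteCast T h').hom) ≫ (discreteMul T a' b').hom =
      (discreteMul T a b).hom ≫ (discreteCast T (congrArg₂ (· * ·) h h')).hom := by
  subst h h'; simp

theorem discreteCast_whiskerRight_mul {a a' : G} (h : a = a') (b : G) :
    (discreteCast T h).hom ▷ T.obj ⟨b⟩ ≫ (discreteMul T a' b).hom =
      (discreteMul T a b).hom ≫ (discreteCast T (congrArg (· * b) h)).hom := by
  subst h; simp

theorem discreteCast_whiskerLeft_mul (a : G) {b b' : G} (h : b = b') :
    T.obj ⟨a⟩ ◁ (discreteCast T h).hom ≫ (discreteMul T a b').hom =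
      (discreteMul T a b).hom ≫ (discreteCast T (congrArg (a * ·) h)).hom := by
  subst h; simp

/-- The canonical isomorphism `(T s)^n ≅ T (s^n)`. -/
def tpowDiscrete (s : G) : (n : ℕ) → (tpow (T.obj ⟨s⟩) n ≅ T.obj ⟨s ^ n⟩)
  | 0 => discreteOne T ≪≫ discreteCast T (pow_zero s).symm
  | n + 1 => whiskerRightIso (tpowDiscrete s n) _ ≪≫ discreteMul T (s ^ n) s ≪≫
      discreteCast T (pow_succ s n).symm

theorem tpowDiscrete_zero (s : G) : (tpowDiscrete T s 0).hom =
    (discreteOne T).hom ≫ (discreteCast T (pow_zero s).symm).hom := rfl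

theorem tpowDiscrete_succ (s : G) (n : ℕ) : (tpowDiscrete T s (n + 1)).hom =
    (tpowDiscrete T s n).hom ▷ T.obj ⟨s⟩ ≫ (discreteMul T (s ^ n) s).hom ≫
      (discreteCast T (pow_succ s n).symm).hom := rfl

/-- Induction on `j`: the unit case is right unitality of `T`, and the step is its associativity
axiom at `s^i`, `s^j`, `s`. -/
theorem tpowAdd_tpowDiscrete (s : G) (i j : ℕ) :
    (tpowAdd (T.obj ⟨s⟩) i j).hom ≫ (tpowDiscrete T s (i + j)).hom =
      ((tpowDiscrete T s i).hom ⊗ₘ (tpowDiscrete T s j).hom) ≫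
        (discreteMul T (s ^ i) (s ^ j)).hom ≫ (discreteCast T (pow_add s i j).symm).hom := by
  induction j with
  | zero =>
    have h := discreteMul_one T (s ^ i)
    rw [tpowDiscrete_zero, MonoidalCategory.tensorHom_def, MonoidalCategory.whiskerLeft_comp]
    simp only [Category.assoc]
    rw [reassoc_of% (discreteCast_whiskerLeft_mul T (s ^ i) (pow_zero s).symm),
      discreteCast_trans]
    erw [h]
    change (ρ_ _).hom ≫ _ = _
    simp
  | succ j ih =>
    have ih' := congrArg (fun f => f ▷ T.obj ⟨s⟩) ih
    simp only [comp_whiskerRight] at ih'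
    have a := discreteMul_assoc T (s ^ i) (s ^ j) s
    change _ ≫ (tpowDiscrete T s ((i + j) + 1)).hom = _
    rw [tpowAdd_succ_hom, tpowDiscrete_succ, Category.assoc, reassoc_of% ih',
      reassoc_of% (discreteCast_whiskerRight_mul T (pow_add s i j).symm s), discreteCast_trans,
      tpowDiscrete_succ, MonoidalCategory.tensorHom_def,
      MonoidalCategory.tensorHom_def, MonoidalCategory.whiskerLeft_comp,
      MonoidalCategory.whiskerLeft_comp]
    simp only [Category.assoc]
    rw [reassoc_of% (discreteCast_whiskerLeft_mul T (s ^ i) (pow_succ s j).symm),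
      discreteCast_trans, ← cancel_epi (α_ _ _ _).hom]
    -- The associativity axiom is extended by a cast so that both its sides end at the exponent `i +
    -- (j + 1)`.
    have a' := congrArg (fun f => f ≫ (discreteCast T
      (by rw [pow_add, pow_succ] : s ^ i * (s ^ j * s) = s ^ (i + (j + 1)))).hom) a
    simp only [Category.assoc, discreteCast_trans] at a'
    simp only [Iso.hom_inv_id_assoc]
    simp only [comp_whiskerRight, Category.assoc]
    erw [a']
    simp

/-- No braiding enters `tpowComm`: it only moves brackets and units, so under `T` it becomes the
equality `s * s^n = s^(n+1)`. The case `n = 0` needs both unit axioms, the step needs associativity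
at `s`, `s^n`, `s`. This is the source of the commutation condition in `ofFunctor`. -/
theorem tpowComm_tpowDiscrete (s : G) (n : ℕ) :
    (tpowComm (T.obj ⟨s⟩) n).hom ≫ (tpowDiscrete T s (n + 1)).hom =
      T.obj ⟨s⟩ ◁ (tpowDiscrete T s n).hom ≫ (discreteMul T s (s ^ n)).hom ≫
        (discreteCast T (pow_succ' s n).symm).hom := by
  induction n with
  | zero =>
    have h := discreteOne_mul T s
    have h' := discreteMul_one T s
    have h2 := congrArg (fun f => f ≫ (discreteCast T
      (by simp : s = s ^ (0 + 1))).hom) h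
    have h3 := congrArg (fun f => f ≫ (discreteCast T
      (by simp : s = s ^ (0 + 1))).hom) h'
    simp only [Category.assoc, discreteCast_trans] at h2 h3
    rw [tpowDiscrete_succ, tpowDiscrete_zero, MonoidalCategory.whiskerLeft_comp, comp_whiskerRight]
    simp only [Category.assoc]
    rw [reassoc_of% (discreteCast_whiskerLeft_mul T s (pow_zero s).symm),
      reassoc_of% (discreteCast_whiskerRight_mul T (pow_zero s).symm s),
      discreteCast_trans, discreteCast_trans]
    erw [h2, h3]
    simp [tpowComm]
  | succ n ih =>
    have ih' := congrArg (fun f => f ▷ T.obj ⟨s⟩) ih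
    simp only [comp_whiskerRight] at ih'
    have a := discreteMul_assoc T s (s ^ n) s
    have a' := congrArg (fun f => f ≫ (discreteCast T
      (by rw [pow_succ' s (n + 1), pow_succ] : s * (s ^ n * s) = s ^ (n + 1 + 1))).hom) a
    simp only [Category.assoc, discreteCast_trans] at a'
    have c : (tpowComm (T.obj ⟨s⟩) (n + 1)).hom =
      (α_ _ _ _).inv ≫ (tpowComm (T.obj ⟨s⟩) n).hom ▷ T.obj ⟨s⟩ := rfl
    rw [tpowDiscrete_succ T s (n + 1), c, Category.assoc]
    erw [reassoc_of% ih']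
    rw [reassoc_of% (discreteCast_whiskerRight_mul T (pow_succ' s n).symm s), discreteCast_trans,
      tpowDiscrete_succ T s n, MonoidalCategory.whiskerLeft_comp, MonoidalCategory.whiskerLeft_comp]
    simp only [Category.assoc]
    rw [reassoc_of% (discreteCast_whiskerLeft_mul T s (pow_succ s n).symm),
      discreteCast_trans, ← cancel_epi (α_ _ _ _).hom]
    simp only [Iso.hom_inv_id_assoc]
    erw [a']
    simp

end DiscreteFunctor
-- Functoriality of tensor powers.
section TensorPowers

variable {D : Type*} [Category D] [MonoidalCategory D]

theorem tpowMap_succ {X Y : D} (f : X ⟶ Y) (n : ℕ) : tpowMap f (n + 1) = tpowMap f n ⊗ₘ f := rfl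

@[simp] theorem tpowMap_id (X : D) (n : ℕ) : tpowMap (𝟙 X) n = 𝟙 (tpow X n) := by
  induction n with
  | zero => rfl
  | succ n ih => simp [tpowMap_succ, ih]

theorem tpowMap_comp {X Y Z : D} (f : X ⟶ Y) (g : Y ⟶ Z) (n : ℕ) :
    tpowMap (f ≫ g) n = tpowMap f n ≫ tpowMap g n := by
  induction n with
  | zero => simp [tpowMap]
  | succ n ih => simp [tpowMap_succ, ih]

theorem tpowAdd_naturality {X Y : D} (f : X ⟶ Y) (i j : ℕ) :
    (tpowAdd X i j).hom ≫ tpowMap f (i + j) =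
      (tpowMap f i ⊗ₘ tpowMap f j) ≫ (tpowAdd Y i j).hom := by
  induction j with
  | zero =>
    change (ρ_ _).hom ≫ tpowMap f i = (tpowMap f i ⊗ₘ 𝟙 (𝟙_ D)) ≫ (ρ_ _).hom
    simp
  | succ j ih =>
    change _ ≫ (tpowMap f (i + j) ⊗ₘ f) = (_ ⊗ₘ (_ ⊗ₘ f)) ≫ _
    rw [tpowAdd_succ_hom, tpowAdd_succ_hom, Category.assoc, ← tensorHom_id, ← tensorHom_id,
      tensorHom_comp_tensorHom, ih, associator_inv_naturality_assoc, tensorHom_comp_tensorHom]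
    simp

/-- Powers start from the unit, so `X^1` is `𝟙 ⊗ X` and not `X`; the triangle identity absorbs the
difference. It removes the unitor built into `toFunctorOne`. -/
theorem whiskerLeft_leftUnitor_inv_tpowAdd_one (X : D) (n : ℕ) :
    tpow X n ◁ (λ_ X).inv ≫ (tpowAdd X n 1).hom = 𝟙 (tpow X (n + 1)) := by
  rw [tpowAdd_succ_hom]
  change _ ≫ _ ≫ (ρ_ _).hom ▷ X = _
  simp

end TensorPowers

namespace CyclicPair

variable {D : Type*} [Category D] [MonoidalCategory D] {m : ℕ}

theorem Equivalent.symm {P Q : CyclicPair D m} (h : P.Equivalent Q) : Q.Equivalent P := by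
  obtain ⟨θ, h⟩ := h
  refine ⟨θ.symm, ?_⟩
  rw [← h, Iso.symm_hom, ← Category.assoc, ← tpowMap_comp]
  simp

theorem Equivalent.trans {P Q R : CyclicPair D m} (h : P.Equivalent Q) (h' : Q.Equivalent R) :
    P.Equivalent R := by
  obtain ⟨θ, h⟩ := h
  obtain ⟨θ', h'⟩ := h'
  exact ⟨θ ≪≫ θ', by rw [Iso.trans_hom, tpowMap_comp, Category.assoc, h', h]⟩

/-! ### The pair attached to a monoidal functor. -/

section ofFunctor

variable {G : Type*} [Monoid G] (T : Discrete G ⥤ D) [T.Monoidal] {s : G} (hs : s ^ m = 1)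

/-- The pair `(T s, T s ^ m ≅ T 1 ≅ 𝟙)` attached to a monoidal functor `T` and an element `s` with
`s ^ m = 1`. -/
def ofFunctor : CyclicPair D m where
  X := T.obj ⟨s⟩
  α := tpowDiscrete T s m ≪≫ discreteCast T hs ≪≫ (discreteOne T).symm
  comm := by
    have h1 := discreteMul_one T s
    have h2 := discreteOne_mul T s
    -- After the unitors are replaced by the unit axioms of `T`, both sides of the condition end in
    -- a cast to `T s`. Here the identity for `tpowComm` is pushed from `s^(m+1)` to `s` to match
    -- them.
    have c := congrArg (fun f => f ≫ (discreteCast T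
      (by rw [pow_succ, hs, one_mul] : s ^ (m + 1) = s)).hom) (tpowComm_tpowDiscrete T s m)
    simp only [tpowDiscrete_succ, Category.assoc, discreteCast_trans] at c
    simp only [Iso.trans_hom, Iso.symm_hom, MonoidalCategory.whiskerLeft_comp, comp_whiskerRight,
      Category.assoc]
    rw [← h1, ← h2, whiskerLeft_inv_hom_assoc, inv_hom_whiskerRight_assoc,
      reassoc_of% (discreteCast_whiskerLeft_mul T s hs),
      reassoc_of% (discreteCast_whiskerRight_mul T hs s), discreteCast_trans, discreteCast_trans, c]

theorem ofFunctor_α_hom : (ofFunctor T hs).α.hom =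
    (tpowDiscrete T s m).hom ≫ (discreteCast T hs).hom ≫ (discreteOne T).inv := rfl

/-- The map `tpowDiscrete` is assembled from unit and tensor constraints, and `e` respects both;
induction on `n`. -/
theorem tpowMap_tpowDiscrete {S T : Discrete G ⥤ D} [S.Monoidal] [T.Monoidal] (e : S ⟶ T)
    [NatTrans.IsMonoidal e] (s : G) (n : ℕ) :
    tpowMap (e.app ⟨s⟩) n ≫ (tpowDiscrete T s n).hom =
      (tpowDiscrete S s n).hom ≫ e.app ⟨s ^ n⟩ := by
  induction n with
  | zero =>
    have h : (discreteOne S).hom ≫ e.app ⟨(1 : G)⟩ = (discreteOne T).hom :=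
      NatTrans.IsMonoidal.unit
    rw [tpowDiscrete_zero, tpowDiscrete_zero, Category.assoc, discreteCast_naturality,
      reassoc_of% h]
    exact Category.id_comp _
  | succ n ih =>
    have h : (discreteMul S (s ^ n) s).hom ≫ e.app ⟨s ^ n * s⟩ =
        (e.app ⟨s ^ n⟩ ⊗ₘ e.app ⟨s⟩) ≫ (discreteMul T (s ^ n) s).hom :=
      NatTrans.IsMonoidal.tensor _ _
    rw [tpowDiscrete_succ, tpowDiscrete_succ, Category.assoc, Category.assoc,
      discreteCast_naturality, reassoc_of% h, tpowMap_succ, ← tensorHom_id, ← tensorHom_id,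
      tensorHom_comp_tensorHom_assoc, tensorHom_comp_tensorHom_assoc, ih]
    simp

theorem ofFunctor_equivalent {S T : Discrete G ⥤ D} [S.Monoidal] [T.Monoidal] (e : S ≅ T)
    [NatTrans.IsMonoidal e.hom] {s : G} (hs : s ^ m = 1) :
    (ofFunctor S hs).Equivalent (ofFunctor T hs) := by
  refine ⟨e.app ⟨s⟩, ?_⟩
  have h : (discreteOne S).hom ≫ e.hom.app ⟨(1 : G)⟩ = (discreteOne T).hom :=
    NatTrans.IsMonoidal.unit
  change tpowMap (e.hom.app ⟨s⟩) m ≫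
      (tpowDiscrete T s m).hom ≫ (discreteCast T hs).hom ≫ (discreteOne T).inv =
    (tpowDiscrete S s m).hom ≫ (discreteCast S hs).hom ≫ (discreteOne S).inv
  rw [reassoc_of% (tpowMap_tpowDiscrete e.hom s m),
    ← reassoc_of% (discreteCast_naturality e.hom hs)]
  congr 2
  rw [Iso.comp_inv_eq, ← h, Iso.inv_hom_id_assoc]

/-! ### Comparison of the functor of a pair with a given monoidal functor. -/

variable {P : CyclicPair D m} {T} {hs} {θ : P.X ⟶ T.obj ⟨s⟩}

/-- The arrow `P.X ^ n ⟶ T (s ^ n)` induced by an arrow `P.X ⟶ T s`. -/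
def toDiscrete (θ : P.X ⟶ T.obj ⟨s⟩) (n : ℕ) : tpow P.X n ⟶ T.obj ⟨s ^ n⟩ :=
  tpowMap θ n ≫ (tpowDiscrete T s n).hom

theorem tpowAdd_toDiscrete (θ : P.X ⟶ T.obj ⟨s⟩) (i j : ℕ) :
    (tpowAdd P.X i j).hom ≫ toDiscrete θ (i + j) =
      (toDiscrete θ i ⊗ₘ toDiscrete θ j) ≫
        (discreteMul T (s ^ i) (s ^ j)).hom ≫ (discreteCast T (pow_add s i j).symm).hom := by
  rw [toDiscrete, ← Category.assoc, tpowAdd_naturality, Category.assoc, tpowAdd_tpowDiscrete,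
    tensorHom_comp_tensorHom_assoc]
  rfl

theorem tpowCast_toDiscrete (θ : P.X ⟶ T.obj ⟨s⟩) {a b : ℕ} (h : a = b) :
    (tpowCast P.X h).hom ≫ toDiscrete θ b =
      toDiscrete θ a ≫ (discreteCast T (congrArg (s ^ ·) h)).hom := by
  subst h; simp

/-- The condition `hθ` enters here: it says that `α` is carried to the composite `T (s^m) = T 1 ≅
𝟙`. After cancelling `tpowAdd`, the drop is `α` whiskered by `X^b`, and right unitality of `T` turns
this into the cast along `s^(b+m) = s^b`. -/
theorem drop_toDiscrete (hθ : tpowMap θ m ≫ (ofFunctor T hs).α.hom = P.α.hom)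
    {a b : ℕ} (h : a = b + m) :
    (P.drop h).hom ≫ toDiscrete θ b =
      toDiscrete θ a ≫ (discreteCast T (by rw [h, pow_add, hs, mul_one])).hom := by
  subst h
  have hα : P.α.hom = toDiscrete θ m ≫ (discreteCast T hs).hom ≫ (discreteOne T).inv := by
    rw [← hθ, ofFunctor_α_hom, toDiscrete, Category.assoc]
  have h1 := discreteMul_one T (s ^ b)
  rw [← cancel_epi (tpowAdd P.X b m).hom, reassoc_of% (P.tpowAdd_drop b),
    reassoc_of% (tpowAdd_toDiscrete θ b m), discreteCast_trans, hα, ← rightUnitor_naturality,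
    whisker_exchange_assoc, ← h1]
  simp only [MonoidalCategory.whiskerLeft_comp, Category.assoc]
  rw [whiskerLeft_inv_hom_assoc, reassoc_of% (discreteCast_whiskerLeft_mul T (s ^ b) hs),
    discreteCast_trans, MonoidalCategory.tensorHom_def, Category.assoc]

theorem dropPow_toDiscrete (hθ : tpowMap θ m ≫ (ofFunctor T hs).α.hom = P.α.hom)
    (q : ℕ) {a b : ℕ} (h : a = b + q * m) (h' : s ^ a = s ^ b) :
    P.dropPow q h ≫ toDiscrete θ b = toDiscrete θ a ≫ (discreteCast T h').hom := by
  induction q generalizing a with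
  | zero =>
    have e : a = b := by simpa using h
    rw [P.dropPow_zero e, tpowCast_toDiscrete]
  | succ q ih =>
    have h1 : a = (b + q * m) + m := by rw [h]; ring
    have e : s ^ (b + q * m) = s ^ b := by
      rw [pow_add, mul_comm, pow_mul, hs, one_pow, mul_one]
    rw [P.dropPow_succ q h1 rfl h, Category.assoc, ih rfl e,
      reassoc_of% (drop_toDiscrete hθ h1), discreteCast_trans]

/-- Both cases of `phi` are handled at once by writing it as `tpowAdd` followed by some number of
drops. This is the tensor half of monoidality in `exists_functor_iso`. -/
theorem phi_toDiscrete [NeZero m] (hθ : tpowMap θ m ≫ (ofFunctor T hs).α.hom = P.α.hom)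
    (i j : ZMod m) (h : s ^ i.val * s ^ j.val = s ^ (i + j).val) :
    (P.phi i j).hom ≫ toDiscrete θ (i + j).val =
      (toDiscrete θ i.val ⊗ₘ toDiscrete θ j.val) ≫
        (discreteMul T (s ^ i.val) (s ^ j.val)).hom ≫ (discreteCast T h).hom := by
  obtain ⟨q, hq, e⟩ := P.exists_phi_eq i j
  rw [e, Category.assoc, dropPow_toDiscrete hθ q hq ((pow_add _ _ _).trans h),
    reassoc_of% (tpowAdd_toDiscrete θ), discreteCast_trans]

end ofFunctor

/-! ### The cyclic group: reconstruction of functors and of pairs. -/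

section Cyclic

theorem ofAdd_one_pow_self (m : ℕ) : (Multiplicative.ofAdd (1 : ZMod m)) ^ m = 1 := by
  rw [← ofAdd_nsmul, nsmul_one, ZMod.natCast_self, ofAdd_zero]

variable [NeZero m]

theorem ofAdd_one_pow_val (g : Multiplicative (ZMod m)) :
    (Multiplicative.ofAdd (1 : ZMod m)) ^ g.toAdd.val = g := by
  rw [← ofAdd_nsmul, nsmul_one, ZMod.natCast_zmod_val, ofAdd_toAdd]

instance isIso_dropPow (P : CyclicPair D m) (q : ℕ) {a b : ℕ} (h : a = b + q * m) :
    IsIso (P.dropPow q h) := by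
  induction q generalizing a with
  | zero => rw [P.dropPow_zero (by simpa using h)]; infer_instance
  | succ q ih =>
    rw [P.dropPow_succ q (by rw [h]; ring) rfl]
    infer_instance

variable (T : Discrete (Multiplicative (ZMod m)) ⥤ D) [T.Monoidal]

theorem exists_functor_iso {P : CyclicPair D m}
    (hP : P.Equivalent (ofFunctor T (ofAdd_one_pow_self m))) :
    ∃ e : P.functor ≅ T, NatTrans.IsMonoidal e.hom := by
  obtain ⟨θ, hθ⟩ := hP
  let k (n : ℕ) : tpow P.X n ⟶ T.obj ⟨Multiplicative.ofAdd 1 ^ n⟩ := toDiscrete θ.hom n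
  have hk : ∀ n, IsIso (k n) := by
    intro n
    have : IsIso (tpowMap θ.hom n) :=
      ⟨tpowMap θ.inv n, by rw [← tpowMap_comp]; simp, by rw [← tpowMap_comp]; simp⟩
    exact IsIso.comp_isIso' this (Iso.isIso_hom _)
  -- The generator raised to the representative of `g` is `g` itself, so the comparison map can be
  -- cast to land in `T g`.
  let c (g : Multiplicative (ZMod m)) : tpow P.X g.toAdd.val ⟶ T.obj ⟨g⟩ :=
    k g.toAdd.val ≫ (discreteCast T (ofAdd_one_pow_val g)).hom
  have hc : ∀ g, IsIso (c g) := fun g => inferInstanceAs (IsIso (_ ≫ _))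
  refine ⟨Discrete.natIso fun x => @asIso _ _ _ _ (c x.as) (hc x.as), ⟨?_, ?_⟩⟩
  · change (tpowCast P.X (ZMod.val_zero (n := m))).inv ≫ c 1 = (discreteOne T).hom
    rw [Iso.inv_comp_eq]
    -- The unit axiom is moved to exponent `0`, where the comparison map is the unit constraint of
    -- `T`.
    have h := congrArg (fun f => f ≫ (discreteCast T (pow_zero _)).hom)
      (tpowCast_toDiscrete (T := T) θ.hom (ZMod.val_zero (n := m)))
    have h0 : toDiscrete (T := T) θ.hom 0 ≫ (discreteCast T (pow_zero _)).hom =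
        (discreteOne T).hom := by
      change (𝟙 _ ≫ (discreteOne T).hom ≫ (discreteCast T _).hom) ≫ _ = _
      simp
    simp only [Category.assoc, discreteCast_trans, h0] at h
    exact h.symm
  · rintro ⟨x⟩ ⟨y⟩
    change (P.phi x.toAdd y.toAdd).hom ≫ toDiscrete θ.hom (x.toAdd + y.toAdd).val ≫
        (discreteCast T (ofAdd_one_pow_val (x * y))).hom =
      ((toDiscrete θ.hom x.toAdd.val ≫ (discreteCast T (ofAdd_one_pow_val x)).hom) ⊗ₘ
        (toDiscrete θ.hom y.toAdd.val ≫ (discreteCast T (ofAdd_one_pow_val y)).hom)) ≫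
        (discreteMul T x y).hom
    have h : Multiplicative.ofAdd (1 : ZMod m) ^ x.toAdd.val *
        Multiplicative.ofAdd 1 ^ y.toAdd.val =
          Multiplicative.ofAdd 1 ^ (x.toAdd + y.toAdd).val := by
      rw [ofAdd_one_pow_val, ofAdd_one_pow_val]
      exact (ofAdd_one_pow_val (x * y)).symm
    rw [reassoc_of% (phi_toDiscrete hθ x.toAdd y.toAdd h), discreteCast_trans,
      ← tensorHom_comp_tensorHom_assoc, discreteCast_mul]

theorem discreteCast_functor (P : CyclicPair D m) {a b : Multiplicative (ZMod m)} (h : a = b) :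
    (discreteCast P.functor h).hom =
      (tpowCast P.X (congrArg (fun g => (Multiplicative.toAdd g).val) h)).hom :=
  P.functor_map (eqToHom (congrArg Discrete.mk h))

/-- The arrow `P.X = P.X ^ 1 ⟶ P.X ^ (1 mod m)`. -/
def toFunctorOne (P : CyclicPair D m) :
    P.X ⟶ P.functor.obj ⟨Multiplicative.ofAdd 1⟩ :=
  -- The number `1 / m` is `0` for `m ≥ 2`, and `1` for `m = 1`, where the generator is trivial and
  -- one drop by `α` is needed. The exponent `0 + 1` makes the source `𝟙 ⊗ X`.
  (λ_ P.X).inv ≫ P.dropPow (1 / m) (a := 0 + 1) (b := (1 : ZMod m).val) (by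
    rw [ZMod.val_one_eq_one_mod, mul_comm, Nat.mod_add_div])

/-- Every constraint of `P.functor` is a canonical map followed by drops, and drops slide through
`tpowAdd`; hence the whole composite collapses to one iterated drop from `X^n` to `X^(n mod m)`. -/
theorem exists_tpowMap_toFunctorOne (P : CyclicPair D m) (n : ℕ) :
    ∃ (q : ℕ) (h : n = (Multiplicative.toAdd (Multiplicative.ofAdd (1 : ZMod m) ^ n)).val + q * m),
      tpowMap P.toFunctorOne n ≫ (tpowDiscrete P.functor (Multiplicative.ofAdd 1) n).hom =
        P.dropPow q h := by
  induction n with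
  | zero =>
    have h0 : 0 = (Multiplicative.toAdd (Multiplicative.ofAdd (1 : ZMod m) ^ 0)).val := by simp
    refine ⟨0, by simp, ?_⟩
    rw [P.dropPow_zero h0, tpowDiscrete_zero, discreteCast_functor]
    change 𝟙 _ ≫ (tpowCast P.X (ZMod.val_zero (n := m))).inv ≫ _ = _
    simp only [tpowCast, eqToIso.hom, eqToIso.inv, Category.id_comp]
    exact eqToHom_trans _ _
  | succ n ih =>
    let s := Multiplicative.ofAdd (1 : ZMod m)
    obtain ⟨q, (h : n = (s ^ n).toAdd.val + q * m), e⟩ := ih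
    obtain ⟨q', h', e'⟩ := P.exists_phi_eq (s ^ n).toAdd s.toAdd
    have h1 : 1 = s.toAdd.val + 1 / m * m := by
      change 1 = (1 : ZMod m).val + _
      rw [ZMod.val_one_eq_one_mod, mul_comm, Nat.mod_add_div]
    have hs : ((s ^ n).toAdd + s.toAdd).val = (s ^ (n + 1)).toAdd.val :=
      congrArg (fun g => (Multiplicative.toAdd g).val) (pow_succ s n).symm
    have a1 : n + 1 = n + s.toAdd.val + 1 / m * m := by omega
    have a2 : n + s.toAdd.val = (s ^ n).toAdd.val + s.toAdd.val + q * m := by omega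
    have a3 : ((s ^ n).toAdd + s.toAdd).val = (s ^ (n + 1)).toAdd.val + 0 * m := by omega
    have a4 : (s ^ n).toAdd.val + s.toAdd.val = (s ^ (n + 1)).toAdd.val + (0 + q') * m := by
      rw [zero_add]; omega
    have a5 : n + s.toAdd.val = (s ^ (n + 1)).toAdd.val + (0 + q' + q) * m := by
      rw [add_mul]; omega
    -- The drops add up: `1 / m` from the new factor, `q` from the induction hypothesis, `q'` from
    -- `phi`, and `0` from the final cast.
    have a6 : n + 1 = (s ^ (n + 1)).toAdd.val + (0 + q' + q + 1 / m) * m :=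
      a1.trans (by rw [a5, add_mul (0 + q' + q), add_assoc])
    refine ⟨_, a6, ?_⟩
    rw [tpowMap_succ, tpowDiscrete_succ, discreteCast_functor, tensorHom_def', Category.assoc,
      ← comp_whiskerRight_assoc, e]
    change tpow P.X n ◁ ((λ_ P.X).inv ≫ P.dropPow (1 / m) h1) ≫ P.dropPow q h ▷ tpow P.X s.toAdd.val
      ≫ (P.phi (s ^ n).toAdd s.toAdd).hom ≫ (tpowCast P.X hs).hom = _
    rw [e', Category.assoc, reassoc_of% (P.dropPow_tpowAdd q s.toAdd.val h a2),
      MonoidalCategory.whiskerLeft_comp, Category.assoc,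
      reassoc_of% (P.tpowAdd_dropPow (1 / m) n h1 a1), ← P.dropPow_zero hs a3,
      P.dropPow_comp q' 0 h' a3 a4, P.dropPow_comp q _ a2 a4 a5, P.dropPow_comp (1 / m) _ a1 a5 a6]
    exact (reassoc_of% (whiskerLeft_leftUnitor_inv_tpowAdd_one P.X n)) _

/-- At `n = m` the residue is `0`, so exactly one block is dropped, and a single drop `X^m → X^0` is
`α` itself up to unit constraints. -/
theorem equivalent_ofFunctor_functor (P : CyclicPair D m) :
    P.Equivalent (ofFunctor P.functor (ofAdd_one_pow_self m)) := by
  have : IsIso P.toFunctorOne := IsIso.comp_isIso' inferInstance (P.isIso_dropPow _ _)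
  refine ⟨@asIso _ _ _ _ P.toFunctorOne this, ?_⟩
  change tpowMap P.toFunctorOne m ≫ (tpowDiscrete P.functor (Multiplicative.ofAdd 1) m).hom ≫
    (discreteCast P.functor (ofAdd_one_pow_self m)).hom ≫ (tpowCast P.X ZMod.val_zero).hom = _
  obtain ⟨q, h, e⟩ := P.exists_tpowMap_toFunctorOne m
  have h0 : (Multiplicative.toAdd (Multiplicative.ofAdd (1 : ZMod m) ^ m)).val = 0 := by
    rw [ofAdd_one_pow_self]
    exact ZMod.val_zero
  obtain rfl : q = 1 := by
    rw [h0, zero_add] at h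
    exact (Nat.eq_of_mul_eq_mul_right (NeZero.pos m) ((one_mul m).trans h)).symm
  have e0 : (discreteCast P.functor (ofAdd_one_pow_self m)).hom ≫
      (tpowCast P.X ZMod.val_zero).hom = P.dropPow 0 (by rw [h0, zero_mul, add_zero]) := by
    rw [discreteCast_functor, P.dropPow_zero h0]
    simp only [tpowCast, eqToIso.hom]
    exact eqToHom_trans _ _
  have a : m = 0 + (0 + 1) * m := by omega
  have a' : m = 0 + m := by omega
  rw [reassoc_of% e, e0]
  refine (P.dropPow_comp 1 0 h _ a).trans ?_
  rw [P.dropPow_succ 0 a' (by simp), P.dropPow_zero rfl, P.drop_eq a']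
  have d := P.tpowAdd_drop 0
  have d' := tpowAdd_zero_left P.X m
  -- This isomorphism is the left unitor of `X^m`; precomposing with it turns the drop at `b = 0`
  -- into `𝟙 ◁ α` followed by a unitor, and the two unitors of `𝟙` agree.
  rw [← cancel_epi ((tpowAdd P.X 0 m).hom ≫ (tpowCast P.X (zero_add m)).hom)]
  have c : (tpowCast P.X (zero_add m)).hom ≫ (tpowCast P.X a').hom = 𝟙 _ := by
    simp [tpowCast]
  simp only [Category.assoc, reassoc_of% c]
  rw [reassoc_of% d, reassoc_of% d']
  change 𝟙_ D ◁ P.α.hom ≫ (ρ_ (𝟙_ D)).hom ≫ 𝟙 _ = _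
  rw [Category.comp_id, ← unitors_equal, leftUnitor_naturality]

end Cyclic

end CyclicPair

/-! ### Actions of the cyclic group on a tensor category. -/

section TensorAction

variable {k : Type*} [Field k] {C : Type*} [Category C] [Preadditive C] [Linear k C]
    [MonoidalCategory C] {m : ℕ}

/-- The pair attached to an action of the cyclic group `C_m`. -/
def TensorAction.toPair (T : TensorAction k C (Multiplicative (ZMod m))) :
    CyclicPair (TensorAut k C) m :=
  CyclicPair.ofFunctor T.toFunctor (CyclicPair.ofAdd_one_pow_self m)

theorem TensorAction.Equivalent.toPair {S T : TensorAction k C (Multiplicative (ZMod m))}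
    (h : S.Equivalent T) : S.toPair.Equivalent T.toPair := by
  obtain ⟨e, he⟩ := h
  exact CyclicPair.ofFunctor_equivalent e _

variable [NeZero m]

theorem TensorAction.ofPair_equivalent {P : CyclicPair (TensorAut k C) m}
    {T : TensorAction k C (Multiplicative (ZMod m))} (h : P.Equivalent T.toPair) :
    (TensorAction.ofPair P).Equivalent T :=
  CyclicPair.exists_functor_iso T.toFunctor h

theorem CyclicPair.equivalent_toPair_ofPair (P : CyclicPair (TensorAut k C) m) :
    P.Equivalent (TensorAction.ofPair P).toPair :=
  P.equivalent_ofFunctor_functor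

theorem TensorAction.ofPair_toPair_equivalent
    (T : TensorAction k C (Multiplicative (ZMod m))) :
    (TensorAction.ofPair T.toPair).Equivalent T :=
  TensorAction.ofPair_equivalent ⟨Iso.refl _, by simp⟩

/-- Forward, `toPair` is applied and each pair is recovered from its action. Backward, `P` is
equivalent to the pair extracted from the action of `Q`, and such an equivalence extends to the
actions. -/
theorem TensorAction.ofPair_equivalent_iff (P Q : CyclicPair (TensorAut k C) m) :
    (TensorAction.ofPair P).Equivalent (TensorAction.ofPair Q) ↔ P.Equivalent Q :=
  ⟨fun h => P.equivalent_toPair_ofPair.trans (h.toPair.trans Q.equivalent_toPair_ofPair.symm),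
    fun h => TensorAction.ofPair_equivalent (h.trans Q.equivalent_toPair_ofPair)⟩

end TensorAction

/-- Actions of the cyclic group `C_m` on a tensor category `C` correspond, up to equivalence, to
pairs `(F, α)` with `F` a tensor autoequivalence of `C` and `α : F^m ≅ id_C` a monoidal natural
isomorphism with `id_F ⊗ α = α ⊗ id_F`; two pairs induce equivalent actions iff there is a monoidal
natural isomorphism `θ : F₁ ≅ F₂` with `α₂ ∘ θ^m = α₁`. -/
theorem mainTheorem7 {k : Type*} [Field k] {C : Type*} [Category C] [Abelian C]
    [Linear k C] [MonoidalCategory C] [IsTensorCategory k C] (m : ℕ) [NeZero m] :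
    (∃ e : Quot (CyclicPair.Equivalent (D := TensorAut k C) (m := m)) ≃
        Quot (TensorAction.Equivalent (k := k) (C := C) (G := Multiplicative (ZMod m))),
      ∀ P : CyclicPair (TensorAut k C) m, e (Quot.mk _ P) = Quot.mk _ (TensorAction.ofPair P)) ∧
    (∀ T : TensorAction k C (Multiplicative (ZMod m)),
      ∃ P : CyclicPair (TensorAut k C) m, (TensorAction.ofPair P).Equivalent T) ∧
    (∀ P₁ P₂ : CyclicPair (TensorAut k C) m,
      (TensorAction.ofPair P₁).Equivalent (TensorAction.ofPair P₂) ↔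
        ∃ θ : P₁.X ≅ P₂.X, tpowMap θ.hom m ≫ P₂.α.hom = P₁.α.hom) := by
  -- The inverse map on classes is induced by `toPair`; the two round trips are the reconstruction
  -- of a pair and of an action.
  refine ⟨⟨⟨Quot.map TensorAction.ofPair fun P Q => (TensorAction.ofPair_equivalent_iff P Q).mpr,
      Quot.map TensorAction.toPair fun _ _ h => h.toPair, ?_, ?_⟩, fun P => rfl⟩,
    fun T => ⟨T.toPair, T.ofPair_toPair_equivalent⟩, TensorAction.ofPair_equivalent_iff⟩
  · rintro ⟨P⟩
    exact (Quot.sound P.equivalent_toPair_ofPair).symm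
  · rintro ⟨T⟩
    exact Quot.sound T.ofPair_toPair_equivalent
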